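/- Let $\mathbb K\in\{\mathbb R,\mathbb C\}$, let $X\neq\{0\}$ be a Banach space over $\mathbb K$, and let $(\Omega,\Sigma,\mu)$ be a finite measure space such that $\Sigma$ contains an infinite sequence of pairwise disjoint sets of positive measure. Let $P_1(\mu,X)$ be the normed space of all ($\mu$-a.e. classes of) strongly $\mu$-measurable functions $f:\Omega\to X$ that are Pettis integrable, i.e. $x^*f\in L_1(\mu)$ for every $x^*\in X^*$ and for every $E\in\Sigma$ there is $x_E\in X$ with $x^*(x_E)=\int_E x^*f\,d\mu$ for all $x^*\in X^*$, equipped with the semivariation norm $$\|f\|=\sup\Big\{\int_\Omega |x^*f(\omega)|\,d\mu(\omega)\;:\;x^*\in X^*,\ \|x^*\|\le 1\Big\}.$$ Then the completion $\widehat{P_1(\mu,X)}$ of $P_1(\mu,X)$ has a quotient isomorphic to $\ell_1$: there is a closed linear subspace $M$ of $\widehat{P_1(\mu,X)}$ such that $\widehat{P_1(\mu,X)}/M$ is linearly homeomorphic to $\ell_1$ (over $\mathbb K$). -/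

import Mathlib

open MeasureTheory

noncomputable section

/-- `f` is Pettis integrable: it is scalarly integrable, and every measurable set `E` has a
Pettis integral `x = ∫_E f dμ` in `X`. (Strong measurability is imposed separately.) -/
def PettisIntegrable (𝕜 : Type*) [RCLike 𝕜] {Ω X : Type*} [MeasurableSpace Ω]
    [NormedAddCommGroup X] [NormedSpace 𝕜 X] (f : Ω → X) (μ : Measure Ω) : Prop :=
  (∀ φ : StrongDual 𝕜 X, Integrable (fun ω => φ (f ω)) μ) ∧
    ∀ E : Set Ω, MeasurableSet E →
      ∃ x : X, ∀ φ : StrongDual 𝕜 X, φ x = ∫ ω in E, φ (f ω) ∂μ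

section

variable {𝕜 : Type*} [RCLike 𝕜] {Ω X : Type*} [MeasurableSpace Ω]
  [NormedAddCommGroup X] [NormedSpace 𝕜 X] {μ : Measure Ω}

theorem PettisIntegrable.congr {f g : Ω → X} (hf : PettisIntegrable 𝕜 f μ) (h : f =ᵐ[μ] g) :
    PettisIntegrable 𝕜 g μ := by
  have key : ∀ φ : StrongDual 𝕜 X, (fun ω => φ (f ω)) =ᵐ[μ] fun ω => φ (g ω) := fun φ =>
    h.fun_comp φ
  refine ⟨fun φ => (hf.1 φ).congr (key φ), fun E hE => ?_⟩
  obtain ⟨x, hx⟩ := hf.2 E hE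
  exact ⟨x, fun φ => (hx φ).trans (integral_congr_ae (ae_restrict_of_ae (key φ)))⟩

theorem PettisIntegrable.zero : PettisIntegrable 𝕜 (fun _ : Ω => (0 : X)) μ :=
  ⟨fun φ => by simp, fun E _ => ⟨0, fun φ => by simp⟩⟩

theorem PettisIntegrable.add {f g : Ω → X} (hf : PettisIntegrable 𝕜 f μ)
    (hg : PettisIntegrable 𝕜 g μ) : PettisIntegrable 𝕜 (fun ω => f ω + g ω) μ := by
  refine ⟨fun φ => by simp only [map_add]; exact (hf.1 φ).add (hg.1 φ), fun E hE => ?_⟩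
  obtain ⟨x, hx⟩ := hf.2 E hE
  obtain ⟨y, hy⟩ := hg.2 E hE
  refine ⟨x + y, fun φ => ?_⟩
  simp only [map_add, hx, hy]
  exact (integral_add (hf.1 φ).integrableOn (hg.1 φ).integrableOn).symm

theorem PettisIntegrable.smul {f : Ω → X} (c : 𝕜) (hf : PettisIntegrable 𝕜 f μ) :
    PettisIntegrable 𝕜 (fun ω => c • f ω) μ := by
  refine ⟨fun φ => by simp only [map_smul]; exact (hf.1 φ).smul c, fun E hE => ?_⟩
  obtain ⟨x, hx⟩ := hf.2 E hE
  refine ⟨c • x, fun φ => ?_⟩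
  simp only [map_smul, hx]
  exact (integral_smul c _).symm

variable (𝕜 X μ) in
/-- The linear space of `μ`-a.e. classes of strongly `μ`-measurable Pettis integrable
functions. -/
def pettisSubmodule : Submodule 𝕜 (Ω →ₘ[μ] X) where
  carrier := {f | PettisIntegrable 𝕜 f μ}
  zero_mem' := PettisIntegrable.zero.congr (AEEqFun.coeFn_zero (β := X)).symm
  add_mem' := fun {f g} hf hg => (PettisIntegrable.add hf hg).congr (AEEqFun.coeFn_add f g).symm
  smul_mem' := fun c f hf => (PettisIntegrable.smul c hf).congr (AEEqFun.coeFn_smul c f).symm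

variable (𝕜 X μ) in
/-- The space `P₁(μ, X)`, as a type of its own, to carry the semivariation norm. -/
def PettisP1 : Type _ := ↥(pettisSubmodule 𝕜 X μ)

namespace PettisP1

instance : AddCommGroup (PettisP1 𝕜 X μ) := inferInstanceAs (AddCommGroup (pettisSubmodule 𝕜 X μ))

instance : Module 𝕜 (PettisP1 𝕜 X μ) := inferInstanceAs (Module 𝕜 (pettisSubmodule 𝕜 X μ))

/-- The underlying `μ`-a.e. class of functions. -/
def toAEEqFun (f : PettisP1 𝕜 X μ) : Ω →ₘ[μ] X := Subtype.val f

/-- The semivariation norm `sup {∫ |x* f| dμ : ‖x*‖ ≤ 1}`. -/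
instance : Norm (PettisP1 𝕜 X μ) :=
  ⟨fun f => sSup {r : ℝ | ∃ φ : StrongDual 𝕜 X, ‖φ‖ ≤ 1 ∧ r = ∫ ω, ‖φ (f.toAEEqFun ω)‖ ∂μ}⟩

theorem norm_def (f : PettisP1 𝕜 X μ) : ‖f‖ =
    sSup {r : ℝ | ∃ φ : StrongDual 𝕜 X, ‖φ‖ ≤ 1 ∧ r = ∫ ω, ‖φ (f.toAEEqFun ω)‖ ∂μ} := rfl

theorem integrable (f : PettisP1 𝕜 X μ) (φ : StrongDual 𝕜 X) :
    Integrable (fun ω => φ (f.toAEEqFun ω)) μ := f.2.1 φ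

/-- The supremum defining the norm is finite. -/
theorem exists_bound (f : PettisP1 𝕜 X μ) :
    ∃ C : ℝ, ∀ φ : StrongDual 𝕜 X, ∫ ω, ‖φ (f.toAEEqFun ω)‖ ∂μ ≤ C * ‖φ‖ := by
  let T : StrongDual 𝕜 X →ₗ[𝕜] (Ω →₁[μ] 𝕜) :=
    { toFun := fun φ => (f.integrable φ).toL1 _
      map_add' := fun φ ψ => Integrable.toL1_add _ _ (f.integrable φ) (f.integrable ψ)
      map_smul' := fun c φ => Integrable.toL1_smul' _ (f.integrable φ) c }
  have hT : Continuous T := by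
    refine T.continuous_of_seq_closed_graph fun u x y hu hTu => ?_
    obtain ⟨ns, hns, hlim⟩ :=
      (tendstoInMeasure_of_tendsto_Lp (p := 1) hTu).exists_seq_tendsto_ae
    have h1 : ∀ᵐ ω ∂μ, ∀ n, (T (u n) : Ω → 𝕜) ω = u n (f.toAEEqFun ω) :=
      ae_all_iff.2 fun n => (f.integrable (u n)).coeFn_toL1
    have h2 : (T x : Ω → 𝕜) =ᵐ[μ] fun ω => x (f.toAEEqFun ω) := (f.integrable x).coeFn_toL1
    refine Lp.ext ?_
    filter_upwards [hlim, h1, h2] with ω hω hω1 hω2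
    rw [hω2]
    refine tendsto_nhds_unique (hω.congr fun n => hω1 (ns n)) ?_
    exact ((ContinuousLinearMap.apply 𝕜 𝕜 (f.toAEEqFun ω)).continuous.tendsto x).comp
      (hu.comp hns.tendsto_atTop)
  refine ⟨‖(⟨T, hT⟩ : StrongDual 𝕜 X →L[𝕜] (Ω →₁[μ] 𝕜))‖, fun φ => ?_⟩
  have h := (⟨T, hT⟩ : StrongDual 𝕜 X →L[𝕜] (Ω →₁[μ] 𝕜)).le_opNorm φ
  refine le_trans (le_of_eq ?_) h
  have h3 : ‖(f.integrable φ).toL1 _‖ = ∫ ω, ‖φ (f.toAEEqFun ω)‖ ∂μ := by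
    rw [L1.norm_eq_integral_norm]
    exact integral_congr_ae ((f.integrable φ).coeFn_toL1.fun_comp norm)
  exact h3.symm

theorem bddAbove (f : PettisP1 𝕜 X μ) : BddAbove
    {r : ℝ | ∃ φ : StrongDual 𝕜 X, ‖φ‖ ≤ 1 ∧ r = ∫ ω, ‖φ (f.toAEEqFun ω)‖ ∂μ} := by
  obtain ⟨C, hC⟩ := f.exists_bound
  refine ⟨|C|, ?_⟩
  rintro r ⟨φ, hφ, rfl⟩
  calc _ ≤ C * ‖φ‖ := hC φ
    _ ≤ |C| * ‖φ‖ := by gcongr; exact le_abs_self C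
    _ ≤ |C| * 1 := by gcongr
    _ = |C| := mul_one _

theorem le_norm (f : PettisP1 𝕜 X μ) {φ : StrongDual 𝕜 X} (hφ : ‖φ‖ ≤ 1) :
    ∫ ω, ‖φ (f.toAEEqFun ω)‖ ∂μ ≤ ‖f‖ := le_csSup f.bddAbove ⟨φ, hφ, rfl⟩

theorem norm_le (f : PettisP1 𝕜 X μ) {C : ℝ}
    (h : ∀ φ : StrongDual 𝕜 X, ‖φ‖ ≤ 1 → ∫ ω, ‖φ (f.toAEEqFun ω)‖ ∂μ ≤ C) : ‖f‖ ≤ C := by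
  refine csSup_le ⟨_, 0, by simp, rfl⟩ ?_
  rintro r ⟨φ, hφ, rfl⟩
  exact h φ hφ

theorem norm_nonneg' (f : PettisP1 𝕜 X μ) : 0 ≤ ‖f‖ :=
  le_trans (by simp) (f.le_norm (φ := 0) (by simp))

theorem norm_smul_le' (c : 𝕜) (f : PettisP1 𝕜 X μ) : ‖c • f‖ ≤ ‖c‖ * ‖f‖ := by
  refine norm_le _ fun φ hφ => ?_
  have h : ∫ ω, ‖φ ((c • f).toAEEqFun ω)‖ ∂μ = ‖c‖ * ∫ ω, ‖φ (f.toAEEqFun ω)‖ ∂μ := by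
    rw [← integral_const_mul]
    refine integral_congr_ae ?_
    filter_upwards [AEEqFun.coeFn_smul c f.toAEEqFun] with ω hω
    have : (c • f).toAEEqFun ω = c • f.toAEEqFun ω := hω
    rw [this, map_smul, norm_smul]
  rw [h]
  exact mul_le_mul_of_nonneg_left (f.le_norm hφ) (norm_nonneg c)

variable (𝕜 X μ) in
theorem normCore : NormedSpace.Core 𝕜 (PettisP1 𝕜 X μ) where
  norm_nonneg := norm_nonneg'
  norm_smul c f := by
    refine le_antisymm (norm_smul_le' c f) ?_
    by_cases hc : c = 0
    · subst hc; simpa using norm_nonneg' _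
    have h := norm_smul_le' c⁻¹ (c • f)
    rw [inv_smul_smul₀ hc, norm_inv] at h
    have hc' : 0 < ‖c‖ := norm_pos_iff.2 hc
    calc ‖c‖ * ‖f‖ ≤ ‖c‖ * (‖c‖⁻¹ * ‖c • f‖) := by gcongr
      _ = ‖c • f‖ := by field_simp
  norm_triangle f g := by
    refine norm_le _ fun φ hφ => ?_
    calc ∫ ω, ‖φ ((f + g).toAEEqFun ω)‖ ∂μ
        ≤ ∫ ω, (‖φ (f.toAEEqFun ω)‖ + ‖φ (g.toAEEqFun ω)‖) ∂μ := by
          refine integral_mono_ae ((f + g).integrable φ).norm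
            ((f.integrable φ).norm.add (g.integrable φ).norm) ?_
          filter_upwards [AEEqFun.coeFn_add f.toAEEqFun g.toAEEqFun] with ω hω
          have : (f + g).toAEEqFun ω = f.toAEEqFun ω + g.toAEEqFun ω := hω
          simp only [this, map_add]
          exact norm_add_le _ _
      _ = _ := integral_add (f.integrable φ).norm (g.integrable φ).norm
      _ ≤ ‖f‖ + ‖g‖ := add_le_add (f.le_norm hφ) (g.le_norm hφ)
  norm_eq_zero_iff f := by
    constructor
    · intro h
      have hzero : ∀ φ : StrongDual 𝕜 X, ‖φ‖ ≤ 1 →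
          ∀ᵐ ω ∂μ, φ (f.toAEEqFun ω) = 0 := fun φ hφ => by
        have h0 : ∫ ω, ‖φ (f.toAEEqFun ω)‖ ∂μ = 0 :=
          le_antisymm (h ▸ f.le_norm hφ) (integral_nonneg fun _ => norm_nonneg _)
        have h1 := (integral_eq_zero_iff_of_nonneg (fun _ => norm_nonneg _)
          (f.integrable φ).norm).1 h0
        filter_upwards [h1] with ω hω
        simpa using hω
      have hall : ∀ φ : StrongDual 𝕜 X, ∀ᵐ ω ∂μ, φ (f.toAEEqFun ω) = 0 := fun φ => by
        by_cases hφ : φ = 0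
        · subst hφ; simp
        have hn : (‖φ‖ : 𝕜) ≠ 0 := by simpa using hφ
        have := hzero ((‖φ‖ : 𝕜)⁻¹ • φ) (le_of_eq (norm_smul_inv_norm hφ))
        filter_upwards [this] with ω hω
        simpa [hφ] using hω
      obtain ⟨t, ht, hft⟩ := f.toAEEqFun.aestronglyMeasurable.isSeparable_ae_range
      have hae : f.toAEEqFun =ᵐ[μ] 0 := ae_eq_zero_of_forall_dual_of_isSeparable 𝕜 ht hall hft
      exact Subtype.ext (AEEqFun.ext (hae.trans AEEqFun.coeFn_zero.symm))
    · rintro rfl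
      have h := norm_smul_le' (0 : 𝕜) (0 : PettisP1 𝕜 X μ)
      rw [smul_zero, norm_zero, zero_mul] at h
      exact le_antisymm h (norm_nonneg' _)

instance : NormedAddCommGroup (PettisP1 𝕜 X μ) := NormedAddCommGroup.ofCore (normCore 𝕜 X μ)

instance : NormedSpace 𝕜 (PettisP1 𝕜 X μ) := NormedSpace.ofCore (normCore 𝕜 X μ)

end PettisP1

end

end

/-- The normed space `E` has a quotient, by a closed linear subspace, that is linearly
homeomorphic to `F`. -/
def HasQuotientIsomorphicTo (𝕜 E F : Type*) [RCLike 𝕜] [NormedAddCommGroup E] [NormedSpace 𝕜 E]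
    [NormedAddCommGroup F] [NormedSpace 𝕜 F] : Prop :=
  ∃ M : Submodule 𝕜 E, IsClosed (M : Set E) ∧ Nonempty ((E ⧸ M) ≃L[𝕜] F)

/-! Choose `x ≠ 0`, a norm-one functional `φ` with `φ x = ‖x‖`, and disjoint sets `E n` of positive
measure. Integrating `φ ∘ f` over each `E n` sends `P₁(μ, X)` to `ℓ₁` contractively, since `∑ |∫_{E
n} φ ∘ f| ≤ ∫ |φ ∘ f| ≤ ‖f‖` (`summable_norm_setIntegral_and_tsum_le`), so it extends to the
completion. Multiples of `x` supported on `E n` lift multiples of the `n`-th unit vector with no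
loss of norm (`setIntegrals_indicatorConst`, `norm_indicatorConst_le`); hence every `a` in `ℓ₁`
lifts to an absolutely convergent series. The extension is therefore onto, and the open mapping
theorem identifies `ℓ₁` with the quotient by its kernel. -/

section

variable {𝕜 : Type*} [RCLike 𝕜] {Ω X : Type*} [MeasurableSpace Ω]
  [NormedAddCommGroup X] [NormedSpace 𝕜 X] {μ : Measure Ω}

/-- A continuous linear surjection between Banach spaces presents its codomain as a quotient of
its domain. -/
theorem HasQuotientIsomorphicTo.of_surjective {E F : Type*} [NormedAddCommGroup E]
    [NormedSpace 𝕜 E] [CompleteSpace E] [NormedAddCommGroup F] [NormedSpace 𝕜 F]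
    [CompleteSpace F] (T : E →L[𝕜] F) (hT : Function.Surjective T) :
    HasQuotientIsomorphicTo 𝕜 E F := by
  have hc : IsClosed (T.ker : Set E) := T.isClosed_ker
  refine ⟨T.ker, hc, ⟨?_⟩⟩
  -- The open mapping theorem makes the inverse continuous; this is where completeness of both
  -- spaces enters.
  refine ContinuousLinearEquiv.ofBijective (T.ker.liftQL T le_rfl) ?_ ?_
  · rw [Submodule.toLinearMap_liftQL]
    exact Submodule.ker_liftQ_eq_bot _ _ _ le_rfl
  · rw [Submodule.toLinearMap_liftQL, Submodule.range_liftQ]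
    exact LinearMap.range_eq_top.2 hT

/-- The integrals of an integrable function over disjoint sets are absolutely summable, with sum at
most the `L¹` norm. -/
theorem summable_norm_setIntegral_and_tsum_le {E : ℕ → Set Ω} (hE : ∀ n, MeasurableSet (E n))
    (hd : Pairwise (Function.onFun Disjoint E)) {g : Ω → 𝕜} (hg : Integrable g μ) :
    Summable (fun n => ‖∫ ω in E n, g ω ∂μ‖) ∧
      ∑' n, ‖∫ ω in E n, g ω ∂μ‖ ≤ ∫ ω, ‖g ω‖ ∂μ := by
  have hs := hasSum_integral_iUnion hE hd hg.norm.integrableOn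
  have hle : ∀ n, ‖∫ ω in E n, g ω ∂μ‖ ≤ ∫ ω in E n, ‖g ω‖ ∂μ := fun n =>
    norm_integral_le_integral_norm _
  have hsum : Summable (fun n => ‖∫ ω in E n, g ω ∂μ‖) :=
    .of_nonneg_of_le (fun _ => norm_nonneg _) hle hs.summable
  refine ⟨hsum, ?_⟩
  calc ∑' n, ‖∫ ω in E n, g ω ∂μ‖ ≤ ∑' n, ∫ ω in E n, ‖g ω‖ ∂μ := hsum.tsum_le_tsum hle hs.summable
    _ = ∫ ω in ⋃ n, E n, ‖g ω‖ ∂μ := hs.tsum_eq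
    _ ≤ ∫ ω, ‖g ω‖ ∂μ :=
      setIntegral_le_integral hg.norm (.of_forall fun _ => norm_nonneg _)

namespace PettisP1

/-- For a functional `φ` in the dual unit ball and disjoint sets `E n`, the operator
`f ↦ (∫_{E n} φ ∘ f dμ)ₙ` from `P₁(μ, X)` to `ℓ₁`. -/
noncomputable def setIntegrals {E : ℕ → Set Ω} (hE : ∀ n, MeasurableSet (E n))
    (hd : Pairwise (Function.onFun Disjoint E)) (φ : StrongDual 𝕜 X) (hφ : ‖φ‖ ≤ 1) :
    PettisP1 𝕜 X μ →L[𝕜] lp (fun _ : ℕ => 𝕜) 1 :=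
  LinearMap.mkContinuous
    { toFun := fun f => ⟨fun n => ∫ ω in E n, φ (f.toAEEqFun ω) ∂μ,
        memℓp_gen (by simpa using (summable_norm_setIntegral_and_tsum_le hE hd (f.integrable φ)).1)⟩
      map_add' := fun f g => by
        refine lp.ext (funext fun n => ?_)
        refine Eq.trans (integral_congr_ae (ae_restrict_of_ae ?_))
          (integral_add (f.integrable φ).integrableOn (g.integrable φ).integrableOn)
        filter_upwards [AEEqFun.coeFn_add f.toAEEqFun g.toAEEqFun] with ω hω
        have : (f + g).toAEEqFun ω = f.toAEEqFun ω + g.toAEEqFun ω := hω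
        simp only [this, map_add]
      map_smul' := fun c f => by
        refine lp.ext (funext fun n => ?_)
        refine Eq.trans (integral_congr_ae (ae_restrict_of_ae ?_)) (integral_smul c _)
        filter_upwards [AEEqFun.coeFn_smul c f.toAEEqFun] with ω hω
        have : (c • f).toAEEqFun ω = c • f.toAEEqFun ω := hω
        simp only [this, map_smul] } 1 fun f => by
    -- The constant is 1 because `φ` lies in the dual unit ball over which the semivariation is a
    -- supremum.
    rw [one_mul, lp.norm_eq_tsum_rpow (by simp)]
    simpa using (summable_norm_setIntegral_and_tsum_le hE hd (f.integrable φ)).2.trans (f.le_norm hφ)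

theorem setIntegrals_apply {E : ℕ → Set Ω} (hE : ∀ n, MeasurableSet (E n))
    (hd : Pairwise (Function.onFun Disjoint E)) (φ : StrongDual 𝕜 X) (hφ : ‖φ‖ ≤ 1)
    (f : PettisP1 𝕜 X μ) (n : ℕ) :
    setIntegrals hE hd φ hφ f n = ∫ ω in E n, φ (f.toAEEqFun ω) ∂μ := rfl

theorem comp_indicator_const {α : Type*} (φ : StrongDual 𝕜 X) (A : Set α) (x : X) (ω : α) :
    φ (A.indicator (fun _ => x) ω) = A.indicator (fun _ => φ x) ω := by
  by_cases h : ω ∈ A <;> simp [h]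

theorem pettisIntegrable_indicator_const [IsFiniteMeasure μ] {A : Set Ω} (hA : MeasurableSet A)
    (x : X) : PettisIntegrable 𝕜 (A.indicator fun _ => x) μ := by
  refine ⟨fun φ => ?_, fun B hB => ⟨((μ.real (A ∩ B) : ℝ) : 𝕜) • x, fun φ => ?_⟩⟩
  · simp only [comp_indicator_const]
    exact (integrable_const _).indicator hA
  · simp only [comp_indicator_const]
    rw [integral_indicator_const _ hA, measureReal_restrict_apply hA, map_smul,
      RCLike.real_smul_eq_coe_mul, smul_eq_mul]

variable (𝕜 μ) in
/-- The class in `P₁(μ, X)` of the function equal to `x` on `A` and to `0` elsewhere. -/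
noncomputable def indicatorConst [IsFiniteMeasure μ] {A : Set Ω} (hA : MeasurableSet A) (x : X) :
    PettisP1 𝕜 X μ :=
  ⟨AEEqFun.mk (A.indicator fun _ => x)
      (stronglyMeasurable_const.indicator hA).aestronglyMeasurable,
    (pettisIntegrable_indicator_const hA x).congr (AEEqFun.coeFn_mk _ _).symm⟩

theorem apply_indicatorConst_ae [IsFiniteMeasure μ] {A : Set Ω} (hA : MeasurableSet A) (x : X)
    (φ : StrongDual 𝕜 X) : (fun ω => φ ((indicatorConst 𝕜 μ hA x).toAEEqFun ω)) =ᵐ[μ]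
      A.indicator fun _ => φ x := by
  filter_upwards [AEEqFun.coeFn_mk (A.indicator fun _ => x)
    (stronglyMeasurable_const.indicator hA).aestronglyMeasurable (μ := μ)] with ω hω
  rw [← comp_indicator_const, ← hω]
  rfl

/-- Each `φ` in the dual unit ball contributes `μ(A) * ‖φ x‖`. The upper bound alone controls the
size of the lifts. -/
theorem norm_indicatorConst_le [IsFiniteMeasure μ] {A : Set Ω} (hA : MeasurableSet A) (x : X) :
    ‖indicatorConst 𝕜 μ hA x‖ ≤ μ.real A * ‖x‖ := by
  refine norm_le _ fun φ hφ => ?_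
  refine (integral_congr_ae ((apply_indicatorConst_ae hA x φ).fun_comp norm)).trans_le ?_
  simp only [Function.comp_def, norm_indicator_eq_indicator_norm]
  rw [integral_indicator_const _ hA, smul_eq_mul]
  gcongr
  simpa using φ.le_of_opNorm_le hφ x

/-- Disjointness annihilates every coordinate except the `n`-th. -/
theorem setIntegrals_indicatorConst [IsFiniteMeasure μ] {E : ℕ → Set Ω}
    (hE : ∀ n, MeasurableSet (E n)) (hd : Pairwise (Function.onFun Disjoint E))
    (φ : StrongDual 𝕜 X) (hφ : ‖φ‖ ≤ 1) (n : ℕ) (x : X) :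
    setIntegrals hE hd φ hφ (indicatorConst 𝕜 μ (hE n) x) =
      lp.single 1 n ((μ.real (E n) : 𝕜) * φ x) := by
  refine lp.ext (funext fun m => ?_)
  rw [setIntegrals_apply,
    integral_congr_ae (ae_restrict_of_ae (apply_indicatorConst_ae (hE n) x φ)),
    integral_indicator_const _ (hE n), measureReal_restrict_apply (hE n), lp.single_apply,
    RCLike.real_smul_eq_coe_mul]
  by_cases h : m = n
  · subst h; simp
  · rw [(hd (Ne.symm h)).inter_eq]
    simp [h]

end PettisP1

end

theorem mainTheorem9 {𝕜 : Type*} [RCLike 𝕜] {Ω : Type*} [MeasurableSpace Ω]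
    (μ : Measure Ω) [IsFiniteMeasure μ]
    (hμ : ∃ E : ℕ → Set Ω, (∀ n, MeasurableSet (E n)) ∧ Pairwise (Function.onFun Disjoint E) ∧
      ∀ n, 0 < μ (E n))
    (X : Type*) [NormedAddCommGroup X] [NormedSpace 𝕜 X] [CompleteSpace X] [Nontrivial X] :
    HasQuotientIsomorphicTo 𝕜 (UniformSpace.Completion (PettisP1 𝕜 X μ))
      (lp (fun _ : ℕ => 𝕜) 1) := by
  obtain ⟨E, hE, hd, hpos⟩ := hμ
  obtain ⟨x, hx⟩ := exists_ne (0 : X)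
  have hx' : ‖x‖ ≠ 0 := norm_ne_zero_iff.2 hx
  obtain ⟨φ, hφ, hφx⟩ := exists_dual_vector 𝕜 x hx'
  have hm : ∀ n, 0 < μ.real (E n) := fun n => ENNReal.toReal_pos (hpos n).ne' (measure_ne_top _ _)
  let ι : PettisP1 𝕜 X μ →L[𝕜] UniformSpace.Completion (PettisP1 𝕜 X μ) :=
    UniformSpace.Completion.toComplL
  let T := (PettisP1.setIntegrals (μ := μ) hE hd φ hφ.le).extend ι
  have hT : ∀ f, T (ι f) = PettisP1.setIntegrals hE hd φ hφ.le f :=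
    ContinuousLinearMap.extend_eq _ UniformSpace.Completion.denseRange_coe
      (UniformSpace.Completion.isUniformInducing_coe _)
  refine .of_surjective T fun a => ?_
  -- The scalar is chosen so that `e n` maps to `a n` times the `n`-th unit vector. As `φ` norms
  -- `x`, the factors `μ (E n)` and `‖x‖` cancel in the bound on `‖e n‖`, leaving `‖a n‖`.
  let e : ℕ → PettisP1 𝕜 X μ := fun n =>
    PettisP1.indicatorConst 𝕜 μ (hE n) ((a n / ((μ.real (E n) : 𝕜) * φ x)) • x)
  have he : ∀ n, ‖ι (e n)‖ ≤ ‖a n‖ := fun n => by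
    refine (UniformSpace.Completion.norm_coe (e n)).le.trans
      ((PettisP1.norm_indicatorConst_le (hE n) _).trans_eq ?_)
    rw [norm_smul, norm_div, norm_mul, hφx, RCLike.norm_ofReal, RCLike.norm_ofReal,
      abs_of_pos (hm n), abs_norm]
    have := (hm n).ne'
    field_simp
  have ha : Summable fun n => ‖a n‖ := by simpa using (lp.memℓp a).summable (by simp)
  have hsum : Summable fun n => ι (e n) := .of_norm_bounded ha he
  refine ⟨∑' n, ι (e n), ?_⟩
  -- By continuity `T` maps the series termwise, and the images form the unit-vector expansion of
  -- `a`, which converges in `ℓ₁` because the exponent is finite.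
  refine (hsum.hasSum.mapL T).unique ?_
  convert lp.hasSum_single ENNReal.one_ne_top a using 2 with n
  rw [hT, PettisP1.setIntegrals_indicatorConst, map_smul, smul_eq_mul]
  have h1 : (μ.real (E n) : 𝕜) ≠ 0 := RCLike.ofReal_ne_zero.2 (hm n).ne'
  have h2 : φ x ≠ 0 := by rw [hφx]; exact RCLike.ofReal_ne_zero.2 hx'
  congr 1
  field_simp
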